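/- **Lemma (Program authority preservation).** Consider the capture calculus $\mathsf{CC}_{<:\Box}$, where $x,y,z$ range over term variables, $X$ over type variables, and everything is taken up to renaming of bound variables (bound variables are chosen distinct from all others, and substitution avoids capture). *Syntax.* Values $v ::= \lambda(x:T)t \mid \lambda[X<:S]t \mid \Box\,x$; terms $s,t ::= v \mid x \mid x\,y \mid x\,[S] \mid \mathsf{let}\ x=s\ \mathsf{in}\ t \mid C\multimap x$ (the last is unboxing); shape types $S ::= X \mid \top \mid \forall(x:U)T \mid \forall[X<:S]T \mid \Box\,T$; types $T,U ::= C\,S$, where $\{\}\,S$ is identified with $S$; capture sets $C$ are finite sets of term variables and possibly the special symbol $*$, which is never bound. Contexts $\Gamma,\Delta$ are lists of bindings $x:T$ and $X<:S$; $\mathrm{dom}(\Gamma)$ never contains $*$. Well-formedness $\Gamma\vdash T\ \mathrm{wf}$ says that all free variables of $T$ are bound in $\Gamma$, where $*$ is also allowed in capture sets. *Captured variables.* $\mathrm{cv}(\lambda(x:T)t)=\mathrm{cv}(t)\setminus\{x\}$; $\mathrm{cv}(\lambda[X<:S]t)=\mathrm{cv}(t)$; $\mathrm{cv}(x)=\mathrm{cv}(x[S])=\{x\}$;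 $\mathrm{cv}(x\,y)=\{x,y\}$; $\mathrm{cv}(\Box\,x)=\{\}$; $\mathrm{cv}(C\multimap x)=C\cup\{x\}$; $\mathrm{cv}(\mathsf{let}\ x=v\ \mathsf{in}\ t)=\mathrm{cv}(t)$ if $v$ is a value and $x\notin\mathrm{cv}(t)$; and $\mathrm{cv}(\mathsf{let}\ x=s\ \mathsf{in}\ t)=\mathrm{cv}(s)\cup(\mathrm{cv}(t)\setminus\{x\})$ in all other cases. *Subcapturing* $\Gamma\vdash C<:C'$ is generated by: $\Gamma\vdash\{x\}<:C$ if $x\in C$ (also for $x=*$); $\Gamma\vdash D<:C$ if $\Gamma\vdash\{x\}<:C$ for all $x\in D$; $\Gamma\vdash\{x\}<:C$ if $x:C'\,S\in\Gamma$ and $\Gamma\vdash C'<:C$. *Subtyping* $\Gamma\vdash T<:U$ is generated by reflexivity, transitivity, and: $\Gamma\vdash X<:S$ if $X<:S\in\Gamma$; $\Gamma\vdash S<:\top$; $\Gamma\vdash\forall(x:U_1)T_1<:\forall(x:U_2)T_2$ if $\Gamma\vdash U_2<:U_1$ and $\Gamma,x:U_2\vdash T_1<:T_2$; $\Gamma\vdash\forall[X<:S_1]T_1<:\forall[X<:S_2]T_2$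 if $\Gamma\vdash S_2<:S_1$ and $\Gamma,X<:S_2\vdash T_1<:T_2$; $\Gamma\vdash C_1S_1<:C_2S_2$ if $\Gamma\vdash C_1<:C_2$ and $\Gamma\vdash S_1<:S_2$; $\Gamma\vdash\Box T_1<:\Box T_2$ if $\Gamma\vdash T_1<:T_2$. *Typing* $\Gamma\vdash t:T$ is generated by: - $\Gamma\vdash x:\{x\}\,S$ if $x:C\,S\in\Gamma$; - $\Gamma\vdash t:U$ if $\Gamma\vdash t:T$, $\Gamma\vdash T<:U$ and $\Gamma\vdash U\ \mathrm{wf}$; - $\Gamma\vdash\lambda(x:U)t:(\mathrm{cv}(t)\setminus\{x\})\,\forall(x:U)T$ if $\Gamma,x:U\vdash t:T$ and $\Gamma\vdash U\ \mathrm{wf}$; - $\Gamma\vdash\lambda[X<:S]t:\mathrm{cv}(t)\,\forall[X<:S]T$ if $\Gamma,X<:S\vdash t:T$ and $\Gamma\vdash S\ \mathrm{wf}$; - $\Gamma\vdash x\,y:[z:=y]T$ if $\Gamma\vdash x:C\,\forall(z:U)T$ and $\Gamma\vdash y:U$; - $\Gamma\vdash x\,[S]:[X:=S]T$ if $\Gamma\vdash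 x:C\,\forall[X<:S]T$; - $\Gamma\vdash\Box\,x:\Box\,C\,S$ if $\Gamma\vdash x:C\,S$ and $C\subseteq\mathrm{dom}(\Gamma)$; - $\Gamma\vdash C\multimap x:C\,S$ if $\Gamma\vdash x:\Box\,C\,S$ and $C\subseteq\mathrm{dom}(\Gamma)$; - $\Gamma\vdash\mathsf{let}\ x=s\ \mathsf{in}\ t:U$ if $\Gamma\vdash s:T$, $\Gamma,x:T\vdash t:U$ and $x$ is not free in $U$. *Evaluation.* With store contexts $\sigma ::= [\,]\mid\mathsf{let}\ x=v\ \mathsf{in}\ \sigma$ and evaluation contexts $e ::= [\,]\mid\mathsf{let}\ x=e\ \mathsf{in}\ t$, the relation $\longrightarrow$ is given by - $\sigma[e[x\,y]]\longrightarrow\sigma[e[[z:=y]t]]$ if $\sigma(x)=\lambda(z:T)t$; - $\sigma[e[x\,[S]]]\longrightarrow\sigma[e[[X:=S]t]]$ if $\sigma(x)=\lambda[X<:S']t$; - $\sigma[e[C\multimap x]]\longrightarrow\sigma[e[y]]$ if $\sigma(x)=\Box\,y$; - $\sigma[e[\mathsf{let}\ x=y\ \mathsf{in}\ t]]\longrightarrow\sigma[e[[x:=y]t]]$;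 - $\sigma[e[\mathsf{let}\ x=v\ \mathsf{in}\ t]]\longrightarrow\sigma[\mathsf{let}\ x=v\ \mathsf{in}\ e[t]]$ if $e\neq[\,]$. *Programs.* A store context matches a context, $\Gamma\vdash\sigma\sim\Delta$, according to: $\Gamma\vdash[\,]\sim\cdot$; and $\Gamma\vdash\mathsf{let}\ x=v\ \mathsf{in}\ \sigma\sim x:T,\Delta$ if $\Gamma\vdash v:T$, $x$ is not free in $T$, and $\Gamma,x:T\vdash\sigma\sim\Delta$. A platform $\Psi$ is a store context in which every bound value has no free term variables. The term $\Psi[t]$ is a well-typed program if $\Psi$ is a platform and for some $\Delta$ and $T$ we have $\vdash\Psi\sim\Delta$ and $\Delta\vdash t:T$, and every $x\in\mathrm{dom}(\Psi)$ has a binding $x:\{*\}\,S\in\Delta$ for some $S$. **Statement.** If $\Psi[t]$ is a well-typed program and $\Psi[t]\longrightarrow\Psi[t']$, then $\mathrm{cv}(t')\subseteq\mathrm{cv}(t)$. -/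

import Mathlib

/-! The capture calculus: a dependently typed variant of System F-sub in monadic normal form,
with capturing types and boxes.

Binding is represented by de Bruijn indices, so that syntactic equality is equality up to
renaming of bound variables. Term variables and type variables are numbered separately: a term
binder shifts only term variables and a type binder shifts only type variables. -/

namespace CC

/-- Elements of capture sets: the universal capability `*`, or a term variable. -/
inductive CVar : Type
  | star : CVar
  | var : ℕ → CVar
  deriving DecidableEq

/-- Capture sets `C`: finite sets of variables and possibly `*`. -/
abbrev CapSet : Type := Finset CVar

mutual

/-- Shape types `S ::= X | ⊤ | ∀(x : U) T | ∀[X <: S] T | □ T`. -/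
inductive Shape : Type
  | tvar : ℕ → Shape
  | top : Shape
  | arr : Ty → Ty → Shape
  | all : Shape → Ty → Shape
  | box : Ty → Shape

/-- Types `T ::= C S`. A shape type `S` used as a type is identified with `{} S`. -/
inductive Ty : Type
  | capt : CapSet → Shape → Ty

end

/-- The shape type `S` as a type, that is `{} S`. -/
def Shape.pure (S : Shape) : Ty := Ty.capt ∅ S

/-- Terms `t ::= x | λ(x : T) t | λ[X <: S] t | □ x | x y | x [S] | let x = s in t | C ⊸ x`. -/
inductive Tm : Type
  | var : ℕ → Tm
  | lam : Ty → Tm → Tm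
  | tlam : Shape → Tm → Tm
  | box : ℕ → Tm
  | app : ℕ → ℕ → Tm
  | tapp : ℕ → Shape → Tm
  | letin : Tm → Tm → Tm
  | unbox : CapSet → ℕ → Tm

/-- Values `v ::= λ(x : T) t | λ[X <: S] t | □ x`. -/
def Tm.isValue : Tm → Bool
  | .lam _ _ => true
  | .tlam _ _ => true
  | .box _ => true
  | _ => false

/-! ### Renaming and substitution -/

/-- Extension of a renaming under a binder. -/
def up (ρ : ℕ → ℕ) : ℕ → ℕ
  | 0 => 0
  | n + 1 => ρ n + 1

/-- The renaming that replaces variable `0` by `y` and removes its binder. -/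
def inst (y : ℕ) : ℕ → ℕ
  | 0 => y
  | n + 1 => n

def CVar.ren (ρ : ℕ → ℕ) : CVar → CVar
  | .star => .star
  | .var i => .var (ρ i)

def CapSet.ren (ρ : ℕ → ℕ) (C : CapSet) : CapSet := C.image (CVar.ren ρ)

mutual

/-- Renaming of term variables by `ρ` and of type variables by `ξ`. -/
def Shape.ren (ρ ξ : ℕ → ℕ) : Shape → Shape
  | .tvar X => .tvar (ξ X)
  | .top => .top
  | .arr U T => .arr (Ty.ren ρ ξ U) (Ty.ren (up ρ) ξ T)
  | .all S T => .all (Shape.ren ρ ξ S) (Ty.ren ρ (up ξ) T)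
  | .box T => .box (Ty.ren ρ ξ T)

def Ty.ren (ρ ξ : ℕ → ℕ) : Ty → Ty
  | .capt C S => .capt (CapSet.ren ρ C) (Shape.ren ρ ξ S)

end

def Tm.ren (ρ ξ : ℕ → ℕ) : Tm → Tm
  | .var x => .var (ρ x)
  | .lam T t => .lam (T.ren ρ ξ) (Tm.ren (up ρ) ξ t)
  | .tlam S t => .tlam (S.ren ρ ξ) (Tm.ren ρ (up ξ) t)
  | .box x => .box (ρ x)
  | .app x y => .app (ρ x) (ρ y)
  | .tapp x S => .tapp (ρ x) (S.ren ρ ξ)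
  | .letin s t => .letin (Tm.ren ρ ξ s) (Tm.ren (up ρ) ξ t)
  | .unbox C x => .unbox (CapSet.ren ρ C) (ρ x)

/-- Weakening of a type by one term binder. -/
def Ty.shift (T : Ty) : Ty := T.ren Nat.succ id

/-- Weakening of a type by one type binder. -/
def Ty.tshift (T : Ty) : Ty := T.ren id Nat.succ

/-- Weakening of a shape type by one term binder. -/
def Shape.shift (S : Shape) : Shape := S.ren Nat.succ id

/-- Weakening of a shape type by one type binder. -/
def Shape.tshift (S : Shape) : Shape := S.ren id Nat.succ

/-- `[z := y] T`, where `z` is the term variable `0`. -/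
def Ty.inst (y : ℕ) (T : Ty) : Ty := T.ren (CC.inst y) id

/-- `[z := y] t`, where `z` is the term variable `0`. -/
def Tm.inst (y : ℕ) (t : Tm) : Tm := t.ren (CC.inst y) id

/-- Extension of a type substitution under a type binder. -/
def upT (τ : ℕ → Shape) : ℕ → Shape
  | 0 => .tvar 0
  | n + 1 => (τ n).tshift

/-- A type substitution under a term binder. -/
def shiftT (τ : ℕ → Shape) : ℕ → Shape := fun n => (τ n).shift

/-- The substitution that replaces type variable `0` by `S` and removes its binder. -/
def instT (S : Shape) : ℕ → Shape
  | 0 => S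
  | n + 1 => .tvar n

mutual

/-- Capture-avoiding simultaneous substitution of shape types for type variables. -/
def Shape.subst (τ : ℕ → Shape) : Shape → Shape
  | .tvar X => τ X
  | .top => .top
  | .arr U T => .arr (Ty.subst τ U) (Ty.subst (shiftT τ) T)
  | .all S T => .all (Shape.subst τ S) (Ty.subst (upT τ) T)
  | .box T => .box (Ty.subst τ T)

def Ty.subst (τ : ℕ → Shape) : Ty → Ty
  | .capt C S => .capt C (Shape.subst τ S)

end

def Tm.subst (τ : ℕ → Shape) : Tm → Tm
  | .var x => .var x
  | .lam T t => .lam (T.subst τ) (Tm.subst (shiftT τ) t)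
  | .tlam S t => .tlam (S.subst τ) (Tm.subst (upT τ) t)
  | .box x => .box x
  | .app x y => .app x y
  | .tapp x S => .tapp x (S.subst τ)
  | .letin s t => .letin (Tm.subst τ s) (Tm.subst (shiftT τ) t)
  | .unbox C x => .unbox C x

/-- `[X := S] T`, where `X` is the type variable `0`. -/
def Ty.tinst (S : Shape) (T : Ty) : Ty := T.subst (instT S)

/-- `[X := S] t`, where `X` is the type variable `0`. -/
def Tm.tinst (S : Shape) (t : Tm) : Tm := t.subst (instT S)

/-! ### Captured and free variables -/

def CVar.pred : CVar → CVar
  | .star => .star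
  | .var i => .var (i - 1)

/-- `C \ x` for the innermost bound variable `x`, read outside the scope of `x`. -/
def CapSet.unbind (C : CapSet) : CapSet := (C.erase (.var 0)).image CVar.pred

/-- The captured variables of a term. -/
def cv : Tm → CapSet
  | .var x => {.var x}
  | .lam _ t => (cv t).unbind
  | .tlam _ t => cv t
  | .box _ => ∅
  | .app x y => {.var x, .var y}
  | .tapp x _ => {.var x}
  | .letin s t =>
      if s.isValue = true ∧ CVar.var 0 ∉ cv t then (cv t).unbind
      else cv s ∪ (cv t).unbind
  | .unbox C x => C ∪ {.var x}

/-- `A \ x` for the innermost bound variable `x`, read outside the scope of `x`. -/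
def unbindVars (A : Finset ℕ) : Finset ℕ := (A.erase 0).image Nat.pred

/-- The term variables in a capture set (all elements but `*`). -/
def CapSet.fv (C : CapSet) : Finset ℕ :=
  C.biUnion fun c => match c with
    | .star => ∅
    | .var i => {i}

mutual

/-- Free term variables of a shape type. -/
def Shape.fv : Shape → Finset ℕ
  | .tvar _ => ∅
  | .top => ∅
  | .arr U T => Ty.fv U ∪ unbindVars (Ty.fv T)
  | .all S T => Shape.fv S ∪ Ty.fv T
  | .box T => Ty.fv T

/-- Free term variables of a type. -/
def Ty.fv : Ty → Finset ℕ
  | .capt C S => C.fv ∪ Shape.fv S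

end

/-- Free term variables of a term, including those in its type annotations. -/
def Tm.fv : Tm → Finset ℕ
  | .var x => {x}
  | .lam T t => T.fv ∪ unbindVars (Tm.fv t)
  | .tlam S t => S.fv ∪ Tm.fv t
  | .box x => {x}
  | .app x y => {x, y}
  | .tapp x S => {x} ∪ S.fv
  | .letin s t => Tm.fv s ∪ unbindVars (Tm.fv t)
  | .unbox C x => C.fv ∪ {x}

/-! ### Typing contexts -/

/-- Bindings `x : T` and `X <: S`. -/
inductive Binding : Type
  | tm : Ty → Binding
  | tp : Shape → Binding

/-- Typing contexts, the most recent binding first: `Γ, x : T` is `.tm T :: Γ`. -/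
abbrev Ctx : Type := List Binding

/-- `x : T ∈ Γ`, with `T` weakened to the whole of `Γ`. -/
inductive HasVar : Ctx → ℕ → Ty → Prop
  | here {Γ : Ctx} {T : Ty} : HasVar (.tm T :: Γ) 0 T.shift
  | there_tm {Γ : Ctx} {x : ℕ} {T U : Ty} :
      HasVar Γ x T → HasVar (.tm U :: Γ) (x + 1) T.shift
  | there_tp {Γ : Ctx} {x : ℕ} {T : Ty} {S : Shape} :
      HasVar Γ x T → HasVar (.tp S :: Γ) x T.tshift

/-- `X <: S ∈ Γ`, with `S` weakened to the whole of `Γ`. -/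
inductive HasTVar : Ctx → ℕ → Shape → Prop
  | here {Γ : Ctx} {S : Shape} : HasTVar (.tp S :: Γ) 0 S.tshift
  | there_tm {Γ : Ctx} {X : ℕ} {S : Shape} {U : Ty} :
      HasTVar Γ X S → HasTVar (.tm U :: Γ) X S.shift
  | there_tp {Γ : Ctx} {X : ℕ} {S R : Shape} :
      HasTVar Γ X S → HasTVar (.tp R :: Γ) (X + 1) S.tshift

/-- The term variables in `dom Γ`, as elements of capture sets; `*` is not among them. -/
def Ctx.dom (Γ : Ctx) : Set CVar := {c | ∃ x T, c = .var x ∧ HasVar Γ x T}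

mutual

/-- `Γ ⊢ S wf`. -/
inductive ShapeWf : Ctx → Shape → Prop
  | tvar {Γ : Ctx} {X : ℕ} {S : Shape} : HasTVar Γ X S → ShapeWf Γ (.tvar X)
  | top {Γ : Ctx} : ShapeWf Γ .top
  | arr {Γ : Ctx} {U T : Ty} : TyWf Γ U → TyWf (.tm U :: Γ) T → ShapeWf Γ (.arr U T)
  | all {Γ : Ctx} {S : Shape} {T : Ty} :
      ShapeWf Γ S → TyWf (.tp S :: Γ) T → ShapeWf Γ (.all S T)
  | box {Γ : Ctx} {T : Ty} : TyWf Γ T → ShapeWf Γ (.box T)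

/-- `Γ ⊢ T wf`. -/
inductive TyWf : Ctx → Ty → Prop
  | capt {Γ : Ctx} {C : CapSet} {S : Shape} :
      ShapeWf Γ S → (C : Set CVar) ⊆ Γ.dom ∪ {CVar.star} → TyWf Γ (.capt C S)

end

/-! ### Subcapturing, subtyping and typing -/

/-- Subcapturing `Γ ⊢ C₁ <: C₂`. -/
inductive SubCapt : Ctx → CapSet → CapSet → Prop
  | elem {Γ : Ctx} {c : CVar} {C : CapSet} : c ∈ C → SubCapt Γ {c} C
  | set {Γ : Ctx} {D C : CapSet} : (∀ c ∈ D, SubCapt Γ {c} C) → SubCapt Γ D C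
  | var {Γ : Ctx} {x : ℕ} {C' C : CapSet} {S : Shape} :
      HasVar Γ x (.capt C' S) → SubCapt Γ C' C → SubCapt Γ {.var x} C

/-- Subtyping `Γ ⊢ T₁ <: T₂`. -/
inductive SubTy : Ctx → Ty → Ty → Prop
  | refl {Γ : Ctx} {T : Ty} : SubTy Γ T T
  | trans {Γ : Ctx} {T₁ T₂ T₃ : Ty} : SubTy Γ T₁ T₂ → SubTy Γ T₂ T₃ → SubTy Γ T₁ T₃
  | tvar {Γ : Ctx} {X : ℕ} {S : Shape} :
      HasTVar Γ X S → SubTy Γ (Shape.tvar X).pure S.pure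
  | top {Γ : Ctx} {S : Shape} : SubTy Γ S.pure Shape.top.pure
  | arr {Γ : Ctx} {U₁ U₂ T₁ T₂ : Ty} :
      SubTy Γ U₂ U₁ → SubTy (.tm U₂ :: Γ) T₁ T₂ →
      SubTy Γ (Shape.arr U₁ T₁).pure (Shape.arr U₂ T₂).pure
  | all {Γ : Ctx} {S₁ S₂ : Shape} {T₁ T₂ : Ty} :
      SubTy Γ S₂.pure S₁.pure → SubTy (.tp S₂ :: Γ) T₁ T₂ →
      SubTy Γ (Shape.all S₁ T₁).pure (Shape.all S₂ T₂).pure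
  | capt {Γ : Ctx} {C₁ C₂ : CapSet} {S₁ S₂ : Shape} :
      SubCapt Γ C₁ C₂ → SubTy Γ S₁.pure S₂.pure → SubTy Γ (.capt C₁ S₁) (.capt C₂ S₂)
  | boxed {Γ : Ctx} {T₁ T₂ : Ty} :
      SubTy Γ T₁ T₂ → SubTy Γ (Shape.box T₁).pure (Shape.box T₂).pure

/-- Typing `Γ ⊢ t : T`. In `letin`, that the bound variable is not free in the result type `U`
is expressed by typing the body with the weakening of a type `U` of the outer context. -/
inductive HasType : Ctx → Tm → Ty → Prop
  | var {Γ : Ctx} {x : ℕ} {C : CapSet} {S : Shape} :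
      HasVar Γ x (.capt C S) → HasType Γ (.var x) (.capt {.var x} S)
  | sub {Γ : Ctx} {t : Tm} {T U : Ty} :
      HasType Γ t T → SubTy Γ T U → TyWf Γ U → HasType Γ t U
  | abs {Γ : Ctx} {t : Tm} {U T : Ty} :
      HasType (.tm U :: Γ) t T → TyWf Γ U →
      HasType Γ (.lam U t) (.capt (cv t).unbind (.arr U T))
  | tabs {Γ : Ctx} {t : Tm} {S : Shape} {T : Ty} :
      HasType (.tp S :: Γ) t T → ShapeWf Γ S →
      HasType Γ (.tlam S t) (.capt (cv t) (.all S T))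
  | app {Γ : Ctx} {x y : ℕ} {C : CapSet} {U T : Ty} :
      HasType Γ (.var x) (.capt C (.arr U T)) → HasType Γ (.var y) U →
      HasType Γ (.app x y) (T.inst y)
  | tapp {Γ : Ctx} {x : ℕ} {C : CapSet} {S : Shape} {T : Ty} :
      HasType Γ (.var x) (.capt C (.all S T)) →
      HasType Γ (.tapp x S) (T.tinst S)
  | box {Γ : Ctx} {x : ℕ} {C : CapSet} {S : Shape} :
      HasType Γ (.var x) (.capt C S) → (C : Set CVar) ⊆ Γ.dom →
      HasType Γ (.box x) (Shape.box (.capt C S)).pure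
  | unbox {Γ : Ctx} {x : ℕ} {C : CapSet} {S : Shape} :
      HasType Γ (.var x) (Shape.box (.capt C S)).pure → (C : Set CVar) ⊆ Γ.dom →
      HasType Γ (.unbox C x) (.capt C S)
  | letin {Γ : Ctx} {s t : Tm} {T U : Ty} :
      HasType Γ s T → HasType (.tm T :: Γ) t U.shift →
      HasType Γ (.letin s t) U

/-! ### Evaluation -/

/-- Store contexts `σ ::= [] | let x = v in σ`, the outermost binding first. That the bound
terms are values is the predicate `Store.IsStore`. -/
abbrev Store : Type := List Tm

def Store.IsStore (σ : Store) : Prop := ∀ v ∈ σ, v.isValue = true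

/-- `σ[t]`. -/
def Store.plug : Store → Tm → Tm
  | [], t => t
  | v :: σ, t => .letin v (Store.plug σ t)

/-- `σ(x)`: the value bound to `x` in `σ`, weakened to the scope of the hole of `σ`. -/
def Store.lookup : Store → ℕ → Option Tm
  | [], _ => none
  | v :: σ, x =>
      if x = σ.length then some (v.ren (fun i => i + (σ.length + 1)) id)
      else Store.lookup σ x

/-- Evaluation contexts `e ::= [] | let x = e in t`, the outermost `let` first; an element of
the list is the body `t` of a `let`, in the scope of its bound variable. -/
abbrev ECtx : Type := List Tm

/-- `e[s]`. -/
def ECtx.plug : ECtx → Tm → Tm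
  | [], s => s
  | t :: e, s => .letin (ECtx.plug e s) t

/-- Weakening of an evaluation context by one term binder. -/
def ECtx.shift (e : ECtx) : ECtx := e.map (Tm.ren (up Nat.succ) id)

/-- Small-step evaluation `t ⟶ t'`. -/
inductive Step : Tm → Tm → Prop
  | apply {σ : Store} {e : ECtx} {x y : ℕ} {T : Ty} {t : Tm} :
      σ.IsStore → σ.lookup x = some (.lam T t) →
      Step (σ.plug (e.plug (.app x y))) (σ.plug (e.plug (t.inst y)))
  | tapply {σ : Store} {e : ECtx} {x : ℕ} {S S' : Shape} {t : Tm} :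
      σ.IsStore → σ.lookup x = some (.tlam S' t) →
      Step (σ.plug (e.plug (.tapp x S))) (σ.plug (e.plug (t.tinst S)))
  | open {σ : Store} {e : ECtx} {C : CapSet} {x y : ℕ} :
      σ.IsStore → σ.lookup x = some (.box y) →
      Step (σ.plug (e.plug (.unbox C x))) (σ.plug (e.plug (.var y)))
  | rename {σ : Store} {e : ECtx} {y : ℕ} {t : Tm} :
      σ.IsStore →
      Step (σ.plug (e.plug (.letin (.var y) t))) (σ.plug (e.plug (t.inst y)))
  | lift {σ : Store} {e : ECtx} {v t : Tm} :
      σ.IsStore → v.isValue = true → e ≠ [] →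
      Step (σ.plug (e.plug (.letin v t))) (σ.plug (.letin v (e.shift.plug t)))

/-! ### Programs -/

/-- `Γ ⊢ σ ∼ Δ`: the store context `σ` matches the context `Δ`. -/
inductive Matches : Ctx → Store → Ctx → Prop
  | nil {Γ : Ctx} : Matches Γ [] []
  | cons {Γ : Ctx} {v : Tm} {σ : Store} {T : Ty} {Δ : Ctx} :
      v.isValue = true → HasType Γ v T → Matches (.tm T :: Γ) σ Δ →
      Matches Γ (v :: σ) (Δ ++ [.tm T])

/-- A platform `Ψ`: a store context whose values have no free variables. -/
def IsPlatform (Ψ : Store) : Prop := ∀ v ∈ Ψ, v.isValue = true ∧ v.fv = ∅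

/-- `Ψ[t]` is a well-typed program: there is `Δ` with `⊢ Ψ ∼ Δ` and `Δ ⊢ t : T` for some `T`,
and every `x ∈ dom Ψ` has a binding `x : {*} S` in `Δ`. -/
def WellTypedProgram (Ψ : Store) (t : Tm) : Prop :=
  IsPlatform Ψ ∧ ∃ Δ : Ctx, Matches [] Ψ Δ ∧ (∃ T : Ty, HasType Δ t T) ∧
    ∀ x < Ψ.length, ∃ S : Shape, HasVar Δ x (.capt {CVar.star} S)

end CC

namespace CC

/-! ### Renaming -/

-- A reduction of `Ψ[t]` takes place inside `t`: the active redex is never a platform binding, so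
-- the store of the step is `Ψ ++ τ` with `τ` a local store, and `t = τ[e[r]]`, `t' = τ[e[r']]`
-- (`Store.prefix_of_plug_eq`; the lifting rule changes the context as well and is treated apart).
-- The captured variables of `τ[u]` are those of `u` after each local variable that occurs is
-- replaced by the captured variables of its value; this operation `resolve τ` preserves unions. A
-- redex is not a value, so `e` contributes to `e[r]` at least what it contributes to `e[r']`. It
-- remains to compare `cv r'` with `cv r` after resolution.
--
-- For application, the captured variables of the value of `x` resolve into those of `x`
-- (`resolve_cv_lookup`): a local variable is by definition resolved to them, and a platform value
-- captures nothing, being closed and, by typing, free of `*`.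
--
-- Unboxing is the only rule that needs the types in an essential way: `C ⊸ x` becomes `y`, and `y`
-- has to be accounted for by `C`. Inversion of typing gives a chain of subcapturings from `{y}` to
-- `C`. Subcapturing is sound for resolution as long as the right-hand side avoids `*`
-- (`SubCapt.resolve_subset`): a local variable is justified by the typing of its value, while
-- looking up a platform variable leads to `{*}`, which lies only below sets containing `*`. The
-- side condition `C ⊆ dom Γ` of unboxing keeps `*` out of `C`.

theorem up_comp (ρ' ρ : ℕ → ℕ) : up ρ' ∘ up ρ = up (ρ' ∘ ρ) := by
  funext n; cases n <;> rfl

theorem CapSet.ren_ren (ρ' ρ : ℕ → ℕ) (C : CapSet) :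
    CapSet.ren ρ' (CapSet.ren ρ C) = CapSet.ren (ρ' ∘ ρ) C := by
  unfold CapSet.ren
  rw [Finset.image_image]
  congr 1
  funext c
  cases c <;> rfl

mutual

theorem Shape.ren_ren (ρ' ξ' ρ ξ : ℕ → ℕ) :
    ∀ S : Shape, (S.ren ρ ξ).ren ρ' ξ' = S.ren (ρ' ∘ ρ) (ξ' ∘ ξ)
  | .tvar X => by simp [Shape.ren]
  | .top => by simp [Shape.ren]
  | .arr U T => by
    simp only [Shape.ren, Ty.ren_ren ρ' ξ' ρ ξ U, Ty.ren_ren (up ρ') ξ' (up ρ) ξ T, up_comp]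
  | .all S T => by
    simp only [Shape.ren, Shape.ren_ren ρ' ξ' ρ ξ S, Ty.ren_ren ρ' (up ξ') ρ (up ξ) T, up_comp]
  | .box T => by simp only [Shape.ren, Ty.ren_ren ρ' ξ' ρ ξ T]

theorem Ty.ren_ren (ρ' ξ' ρ ξ : ℕ → ℕ) :
    ∀ T : Ty, (T.ren ρ ξ).ren ρ' ξ' = T.ren (ρ' ∘ ρ) (ξ' ∘ ξ)
  | .capt C S => by simp only [Ty.ren, Shape.ren_ren ρ' ξ' ρ ξ S, CapSet.ren_ren]

end

theorem Tm.ren_ren (ρ' ξ' ρ ξ : ℕ → ℕ) (t : Tm) :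
    (t.ren ρ ξ).ren ρ' ξ' = t.ren (ρ' ∘ ρ) (ξ' ∘ ξ) := by
  induction t generalizing ρ' ξ' ρ ξ <;>
    simp_all [Tm.ren, Ty.ren_ren, Shape.ren_ren, CapSet.ren_ren, up_comp]

@[simp] theorem Tm.isValue_ren (ρ ξ : ℕ → ℕ) (t : Tm) : (t.ren ρ ξ).isValue = t.isValue := by
  cases t <;> rfl

@[simp] theorem Tm.isValue_subst (τ : ℕ → Shape) (t : Tm) : (t.subst τ).isValue = t.isValue := by
  cases t <;> rfl

/-! ### Membership in capture sets -/

theorem CapSet.star_mem_unbind {A : CapSet} : CVar.star ∈ A.unbind ↔ CVar.star ∈ A := by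
  simp only [CapSet.unbind, Finset.mem_image, Finset.mem_erase]
  constructor
  · rintro ⟨c, ⟨_, hc⟩, h⟩
    cases c with
    | star => exact hc
    | var i => cases h
  · exact fun h => ⟨.star, ⟨by simp, h⟩, rfl⟩

theorem CapSet.var_mem_unbind {A : CapSet} {i : ℕ} :
    CVar.var i ∈ A.unbind ↔ CVar.var (i + 1) ∈ A := by
  simp only [CapSet.unbind, Finset.mem_image, Finset.mem_erase]
  constructor
  · rintro ⟨c, ⟨hc0, hc⟩, h⟩
    cases c with
    | star => cases h
    | var j =>
      cases j with
      | zero => exact absurd rfl hc0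
      | succ j =>
        simp only [CVar.pred, Nat.add_sub_cancel, CVar.var.injEq] at h
        exact h ▸ hc
  · exact fun h => ⟨.var (i + 1), ⟨by simp, h⟩, rfl⟩

theorem mem_unbindVars {A : Finset ℕ} {i : ℕ} : i ∈ unbindVars A ↔ i + 1 ∈ A := by
  simp only [unbindVars, Finset.mem_image, Finset.mem_erase]
  constructor
  · rintro ⟨j, ⟨hj0, hj⟩, rfl⟩
    rwa [Nat.pred_eq_sub_one, Nat.sub_add_cancel (Nat.pos_of_ne_zero hj0)]
  · exact fun h => ⟨i + 1, ⟨by omega, h⟩, rfl⟩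

theorem CapSet.star_mem_ren {ρ : ℕ → ℕ} {A : CapSet} :
    CVar.star ∈ CapSet.ren ρ A ↔ CVar.star ∈ A := by
  simp only [CapSet.ren, Finset.mem_image]
  constructor
  · rintro ⟨c, hc, h⟩
    cases c with
    | star => exact hc
    | var i => cases h
  · exact fun h => ⟨.star, h, rfl⟩

theorem CapSet.var_mem_ren {ρ : ℕ → ℕ} {A : CapSet} {i : ℕ} :
    CVar.var i ∈ CapSet.ren ρ A ↔ ∃ j, CVar.var j ∈ A ∧ ρ j = i := by
  simp only [CapSet.ren, Finset.mem_image]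
  constructor
  · rintro ⟨c, hc, h⟩
    cases c with
    | star => cases h
    | var j => exact ⟨j, hc, by simpa [CVar.ren] using h⟩
  · rintro ⟨j, hj, rfl⟩
    exact ⟨.var j, hj, rfl⟩

theorem CapSet.unbind_ren_up (ρ : ℕ → ℕ) (A : CapSet) :
    (CapSet.ren (up ρ) A).unbind = CapSet.ren ρ A.unbind := by
  ext c
  cases c with
  | star => simp [CapSet.star_mem_unbind, CapSet.star_mem_ren]
  | var i =>
    simp only [CapSet.var_mem_unbind, CapSet.var_mem_ren]
    constructor
    · rintro ⟨j, hj, h⟩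
      cases j with
      | zero => simp [up] at h
      | succ j => exact ⟨j, hj, by simpa [up] using h⟩
    · rintro ⟨j, hj, rfl⟩
      exact ⟨j + 1, hj, rfl⟩

theorem CapSet.zero_mem_ren_up {ρ : ℕ → ℕ} {A : CapSet} :
    CVar.var 0 ∈ CapSet.ren (up ρ) A ↔ CVar.var 0 ∈ A := by
  rw [CapSet.var_mem_ren]
  constructor
  · rintro ⟨j, hj, h⟩
    cases j with
    | zero => exact hj
    | succ j => simp [up] at h
  · exact fun h => ⟨0, h, rfl⟩

theorem CapSet.zero_notMem_ren_succ (A : CapSet) : CVar.var 0 ∉ CapSet.ren Nat.succ A := by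
  rw [CapSet.var_mem_ren]
  rintro ⟨j, _, h⟩
  exact Nat.succ_ne_zero j h

theorem CapSet.unbind_ren_succ (A : CapSet) : (CapSet.ren Nat.succ A).unbind = A := by
  ext c
  cases c with
  | star => simp [CapSet.star_mem_unbind, CapSet.star_mem_ren]
  | var i => simp [CapSet.var_mem_unbind, CapSet.var_mem_ren]

theorem CapSet.unbind_union (A B : CapSet) : (A ∪ B).unbind = A.unbind ∪ B.unbind := by
  ext c
  cases c <;> simp [CapSet.star_mem_unbind, CapSet.var_mem_unbind]

theorem CapSet.ren_inst_subset (y : ℕ) (A : CapSet) :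
    CapSet.ren (CC.inst y) A ⊆ {.var y} ∪ A.unbind := by
  intro c hc
  cases c with
  | star =>
    rw [CapSet.star_mem_ren] at hc
    simp [CapSet.star_mem_unbind, hc]
  | var i =>
    obtain ⟨j, hj, rfl⟩ := CapSet.var_mem_ren.1 hc
    cases j with
    | zero => simp [CC.inst]
    | succ j => exact Finset.mem_union_right _ (CapSet.var_mem_unbind.2 hj)

/-! ### Captured variables -/

/-- Injectivity of `ρ` is not needed: the `let` clause only tests for the bound variable, and `up ρ`
sends nothing else to `0`. -/
theorem cv_ren (ρ ξ : ℕ → ℕ) (t : Tm) : cv (t.ren ρ ξ) = CapSet.ren ρ (cv t) := by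
  induction t generalizing ρ ξ with
  | letin s t ihs iht =>
    simp only [Tm.ren, cv, Tm.isValue_ren, ihs, iht, CapSet.zero_mem_ren_up,
      CapSet.unbind_ren_up]
    split_ifs
    · rfl
    · simp [CapSet.ren, Finset.image_union]
  | lam T t ih => simp [Tm.ren, cv, ih, CapSet.unbind_ren_up]
  | tlam S t ih => simp [Tm.ren, cv, ih]
  | _ => simp [Tm.ren, cv, CapSet.ren, CVar.ren]

theorem cv_subst (τ : ℕ → Shape) (t : Tm) : cv (t.subst τ) = cv t := by
  induction t generalizing τ <;> simp_all [Tm.subst, cv]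

theorem cv_inst_subset (y : ℕ) (t : Tm) : cv (t.inst y) ⊆ {.var y} ∪ (cv t).unbind := by
  rw [Tm.inst, cv_ren]
  exact CapSet.ren_inst_subset y (cv t)

theorem cv_letin_subset (s t : Tm) : cv (.letin s t) ⊆ cv s ∪ (cv t).unbind := by
  rw [cv]
  split_ifs
  · exact Finset.subset_union_right
  · exact subset_rfl

theorem cv_letin_of_not_isValue {s : Tm} (hs : s.isValue = false) (t : Tm) :
    cv (.letin s t) = cv s ∪ (cv t).unbind := by
  simp [cv, hs]

/-- Needed to turn closedness of platform values into emptiness of their captured variables. -/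
theorem mem_fv_of_mem_cv {t : Tm} {i : ℕ} (h : CVar.var i ∈ cv t) : i ∈ t.fv := by
  induction t generalizing i with
  | letin s t ihs iht =>
    rcases Finset.mem_union.1 (cv_letin_subset s t h) with h | h
    · exact Finset.mem_union_left _ (ihs h)
    · exact Finset.mem_union_right _ (mem_unbindVars.2 (iht (CapSet.var_mem_unbind.1 h)))
  | lam T t ih =>
    exact Finset.mem_union_right _ (mem_unbindVars.2 (ih (CapSet.var_mem_unbind.1 h)))
  | tlam S t ih => exact Finset.mem_union_right _ (ih h)
  | unbox C x =>
    rcases Finset.mem_union.1 h with h | h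
    · exact Finset.mem_union_left _ (Finset.mem_biUnion.2 ⟨_, h, by simp⟩)
    · exact Finset.mem_union_right _ (by simpa using h)
  | tapp x S => exact Finset.mem_union_left _ (by simpa [cv] using h)
  | var | app => simpa [cv, Tm.fv] using h
  | box x => simp [cv] at h

theorem star_notMem_dom (Γ : Ctx) : CVar.star ∉ Γ.dom := by
  rintro ⟨x, T, h, _⟩
  cases h

/-- Only an unboxing could put `*` into `cv`, and its typing rule confines `C` to the domain of the
context. -/
theorem HasType.star_notMem_cv {Γ : Ctx} {t : Tm} {T : Ty} (h : HasType Γ t T) :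
    CVar.star ∉ cv t := by
  induction h with
  | var | app | tapp | box => simp [cv]
  | sub _ _ _ ih => exact ih
  | abs _ _ ih => simpa [cv, CapSet.star_mem_unbind] using ih
  | tabs _ _ ih => exact ih
  | unbox _ hC _ =>
    simp only [cv, Finset.mem_union, Finset.mem_singleton, reduceCtorEq, or_false]
    exact fun h => star_notMem_dom _ (hC h)
  | letin _ _ ihs iht =>
    intro h
    rcases Finset.mem_union.1 (cv_letin_subset _ _ h) with h | h
    · exact ihs h
    · exact iht (CapSet.star_mem_unbind.1 h)

/-! ### Inversion of subcapturing, subtyping and typing -/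

theorem SubCapt.of_mem {Γ : Ctx} {D C : CapSet} {c : CVar} (h : SubCapt Γ D C) (hc : c ∈ D) :
    SubCapt Γ {c} C := by
  cases h with
  | elem hm => rw [Finset.mem_singleton.1 hc]; exact .elem hm
  | set h => exact h c hc
  | var hx h => rw [Finset.mem_singleton.1 hc]; exact .var hx h

theorem SubCapt.trans {Γ : Ctx} {A B C : CapSet} (h : SubCapt Γ A B) (h' : SubCapt Γ B C) :
    SubCapt Γ A C := by
  induction h with
  | elem hm => exact h'.of_mem hm
  | set _ ih => exact .set fun c hc => ih c hc h'
  | var hx _ ih => exact .var hx (ih h')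

theorem SubCapt.refl (Γ : Ctx) (C : CapSet) : SubCapt Γ C C := .set fun _ hc => .elem hc

/-- The lookup rule never applies to `*`, so `*` survives to the right. Read contrapositively, a
`*`-free upper bound makes everything below it `*`-free. -/
theorem SubCapt.star_mem {Γ : Ctx} {D C : CapSet} (h : SubCapt Γ D C) (hD : CVar.star ∈ D) :
    CVar.star ∈ C := by
  induction h with
  | elem hm => rwa [Finset.mem_singleton.1 hD]
  | set _ ih => exact ih _ hD (Finset.mem_singleton_self _)
  | var _ _ _ => simp at hD

/-- The capture set of a type. -/
def Ty.cs : Ty → CapSet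
  | .capt C _ => C

/-- The shape of a type. -/
def Ty.shape : Ty → Shape
  | .capt _ S => S

theorem SubTy.cs {Γ : Ctx} {T U : Ty} (h : SubTy Γ T U) : SubCapt Γ T.cs U.cs := by
  induction h with
  | trans _ _ ih₁ ih₂ => exact ih₁.trans ih₂
  | capt h _ _ => exact h
  | _ => exact SubCapt.refl _ _

theorem SubTy.shape_top {Γ : Ctx} {T U : Ty} (h : SubTy Γ T U) (hT : T.shape = .top) :
    U.shape = .top := by
  induction h with
  | refl => exact hT
  | trans _ _ ih₁ ih₂ => exact ih₂ (ih₁ hT)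
  | capt _ _ ih => exact ih hT
  | top => rfl
  | _ => cases hT

/-- Induction on the derivation; transitivity may pass through `⊤`, which is why that alternative
must be carried along. -/
theorem SubTy.shape_box {Γ : Ctx} {T U T' : Ty} (h : SubTy Γ T U) (hT : T.shape = .box T') :
    U.shape = .top ∨ ∃ U', U.shape = .box U' ∧ SubCapt Γ T'.cs U'.cs := by
  induction h generalizing T' with
  | refl => exact .inr ⟨T', hT, SubCapt.refl _ _⟩
  | trans _ h₂ ih₁ ih₂ =>
    rcases ih₁ hT with h | ⟨U', h, hs⟩
    · exact .inl (h₂.shape_top h)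
    · rcases ih₂ h with h | ⟨U'', h, hs'⟩
      · exact .inl h
      · exact .inr ⟨U'', h, hs.trans hs'⟩
  | capt _ _ ih => exact ih hT
  | top => exact .inl rfl
  | boxed h _ =>
    cases hT
    exact .inr ⟨_, rfl, h.cs⟩
  | _ => cases hT

theorem HasType.var_inv {Γ : Ctx} {x : ℕ} {T : Ty} (h : HasType Γ (.var x) T) :
    ∃ C S, HasVar Γ x (.capt C S) ∧ SubTy Γ (.capt {.var x} S) T := by
  generalize ht : Tm.var x = t at h
  induction h with
  | var hx => cases ht; exact ⟨_, _, hx, .refl⟩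
  | sub _ hs _ ih =>
    obtain ⟨C, S, hx, h⟩ := ih ht
    exact ⟨C, S, hx, h.trans hs⟩
  | _ => cases ht

theorem HasType.unbox_inv {Γ : Ctx} {C : CapSet} {x : ℕ} {T : Ty}
    (h : HasType Γ (.unbox C x) T) :
    ∃ S, HasType Γ (.var x) (Shape.box (.capt C S)).pure ∧ (C : Set CVar) ⊆ Γ.dom := by
  generalize ht : Tm.unbox C x = t at h
  induction h with
  | unbox hx hC => cases ht; exact ⟨_, hx, hC⟩
  | sub _ _ _ ih => exact ih ht
  | _ => cases ht

theorem HasType.letin_inv {Γ : Ctx} {s t : Tm} {U : Ty} (h : HasType Γ (.letin s t) U) :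
    ∃ T U', HasType Γ s T ∧ HasType (.tm T :: Γ) t U' := by
  generalize ht : Tm.letin s t = r at h
  induction h with
  | letin hs hb => cases ht; exact ⟨_, _, hs, hb⟩
  | sub _ _ _ ih => exact ih ht
  | _ => cases ht

theorem HasType.subCapt_of_var {Γ : Ctx} {x : ℕ} {T : Ty} (h : HasType Γ (.var x) T) :
    SubCapt Γ {.var x} T.cs := by
  obtain ⟨C, S, _, hs⟩ := h.var_inv
  exact hs.cs

theorem HasType.box_inv {Γ : Ctx} {y : ℕ} {T : Ty} (h : HasType Γ (.box y) T) :
    T.shape = .top ∨ ∃ T', T.shape = .box T' ∧ SubCapt Γ {.var y} T'.cs := by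
  generalize ht : Tm.box y = t at h
  induction h with
  | box hy _ => cases ht; exact .inr ⟨_, rfl, hy.subCapt_of_var⟩
  | sub _ hs _ ih =>
    rcases ih ht with h | ⟨T', h, hc⟩
    · exact .inl (hs.shape_top h)
    · rcases hs.shape_box h with h | ⟨U', h, hc'⟩
      · exact .inl h
      · exact .inr ⟨U', h, hc.trans hc'⟩
  | _ => cases ht

/-- The introduction rules for values record exactly `cv v` in the type, and subsumption only moves
up in subcapturing. -/
theorem HasType.cv_value_subCapt {Γ : Ctx} {v : Tm} {T : Ty} (h : HasType Γ v T)
    (hv : v.isValue = true) : SubCapt Γ (cv v) T.cs := by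
  induction h with
  | sub _ hs _ ih => exact (ih hv).trans hs.cs
  | abs | tabs | box => exact SubCapt.refl _ _
  | _ => cases hv

theorem HasType.of_plug {Γ : Ctx} {e : ECtx} {u : Tm} {T : Ty} (h : HasType Γ (e.plug u) T) :
    ∃ U, HasType Γ u U := by
  induction e generalizing T with
  | nil => exact ⟨T, h⟩
  | cons b e ih =>
    obtain ⟨_, _, hs, _⟩ := HasType.letin_inv h
    exact ih hs

/-! ### Captured variables under store contexts -/

/-- The captured variables of `let x = v in t` for a value `v`, where `A` are those of `t`. -/
def bindCv (v : Tm) (A : CapSet) : CapSet :=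
  A.unbind ∪ if CVar.var 0 ∈ A then cv v else ∅

/-- The captured variables of `σ[t]` for a store context `σ`, where `A` are those of `t`. -/
def resolve : Store → CapSet → CapSet
  | [], A => A
  | v :: σ, A => bindCv v (resolve σ A)

/-- Since the bound terms are values, each `let` counts `cv v` only if its variable is captured by
the body, which is the test in `bindCv`. -/
theorem cv_plug {σ : Store} (hσ : σ.IsStore) (u : Tm) : cv (σ.plug u) = resolve σ (cv u) := by
  induction σ with
  | nil => rfl
  | cons v σ ih =>
    have ih := ih fun w hw => hσ w (List.mem_cons_of_mem _ hw)
    have hv := hσ v List.mem_cons_self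
    simp only [Store.plug, cv, resolve, bindCv, ih, hv, true_and]
    by_cases h : CVar.var 0 ∈ resolve σ (cv u)
    · simp [h, Finset.union_comm]
    · simp [h]

theorem resolve_append (σ τ : Store) (A : CapSet) :
    resolve (σ ++ τ) A = resolve σ (resolve τ A) := by
  induction σ with
  | nil => rfl
  | cons v σ ih => simp [resolve, ih]

theorem resolve_snoc (σ : Store) (v : Tm) (A : CapSet) :
    resolve (σ ++ [v]) A = resolve σ (bindCv v A) := resolve_append σ [v] A

theorem bindCv_union (v : Tm) (A B : CapSet) : bindCv v (A ∪ B) = bindCv v A ∪ bindCv v B := by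
  simp only [bindCv, CapSet.unbind_union, Finset.mem_union]
  by_cases hA : CVar.var 0 ∈ A <;> by_cases hB : CVar.var 0 ∈ B <;> simp only [hA, hB] <;>
    ext c <;> simp <;> tauto

theorem bindCv_empty (v : Tm) : bindCv v ∅ = ∅ := by
  simp [bindCv, CapSet.unbind]

/-- A weakened set does not mention the new variable. This is what lets the inductions over stores
peel off the innermost binding, whose variable has index `0`. -/
theorem bindCv_ren_succ (v : Tm) (A : CapSet) : bindCv v (CapSet.ren Nat.succ A) = A := by
  simp [bindCv, CapSet.unbind_ren_succ, CapSet.zero_notMem_ren_succ]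

theorem bindCv_zero (v : Tm) : bindCv v {.var 0} = cv v := by
  simp [bindCv, CapSet.unbind]

theorem bindCv_succ (v : Tm) (x : ℕ) : bindCv v {.var (x + 1)} = {.var x} := by
  simpa [CapSet.ren, CVar.ren] using bindCv_ren_succ v {.var x}

theorem resolve_union (σ : Store) (A B : CapSet) :
    resolve σ (A ∪ B) = resolve σ A ∪ resolve σ B := by
  induction σ with
  | nil => rfl
  | cons v σ ih => simp [resolve, ih, bindCv_union]

theorem resolve_empty (σ : Store) : resolve σ ∅ = ∅ := by
  induction σ with
  | nil => rfl
  | cons v σ ih => simp [resolve, ih, bindCv_empty]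

theorem resolve_mono (σ : Store) {A B : CapSet} (h : A ⊆ B) : resolve σ A ⊆ resolve σ B := by
  rw [← Finset.union_eq_right.2 h, resolve_union]
  exact Finset.subset_union_left

theorem resolve_subset_of_forall (σ : Store) {A B : CapSet}
    (h : ∀ c ∈ A, resolve σ {c} ⊆ B) : resolve σ A ⊆ B := by
  induction A using Finset.induction_on with
  | empty => simp [resolve_empty]
  | insert c A _ ih =>
    rw [Finset.insert_eq, resolve_union]
    exact Finset.union_subset (h c (Finset.mem_insert_self c A))
      (ih fun d hd => h d (Finset.mem_insert_of_mem hd))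

/-! ### Store lookup -/

theorem Store.lookup_snoc_zero (σ : Store) (v : Tm) :
    Store.lookup (σ ++ [v]) 0 = some (v.ren Nat.succ id) := by
  induction σ with
  | nil => rfl
  | cons w σ ih => simp [Store.lookup, ih]

theorem Store.lookup_snoc_succ (σ : Store) (v : Tm) (x : ℕ) :
    Store.lookup (σ ++ [v]) (x + 1) = (Store.lookup σ x).map (Tm.ren Nat.succ id) := by
  induction σ with
  | nil => simp [Store.lookup]
  | cons w σ ih =>
    simp only [List.cons_append, Store.lookup, List.length_append, List.length_singleton,
      Nat.add_right_cancel_iff, ih]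
    split_ifs
    · simp only [Option.map_some, Tm.ren_ren]
      rfl
    · rfl

theorem Store.exists_of_lookup {σ : Store} {x : ℕ} {w : Tm} (h : σ.lookup x = some w) :
    ∃ v ∈ σ, ∃ ρ, w = v.ren ρ id := by
  induction σ with
  | nil => cases h
  | cons v σ ih =>
    rw [Store.lookup] at h
    split_ifs at h
    · cases h
      exact ⟨v, List.mem_cons_self, _, rfl⟩
    · obtain ⟨u, hu, hw⟩ := ih h
      exact ⟨u, List.mem_cons_of_mem _ hu, hw⟩

theorem Matches.star_notMem_cv {Γ Δ : Ctx} {σ : Store} (h : Matches Γ σ Δ) :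
    ∀ v ∈ σ, CVar.star ∉ cv v := by
  induction h with
  | nil => simp
  | cons _ hv _ ih =>
    intro w hw
    rcases List.mem_cons.1 hw with rfl | hw
    · exact hv.star_notMem_cv
    · exact ih w hw

theorem cv_eq_empty_of_lookup {Ψ : Store} {Γ Δ : Ctx} (hΨ : IsPlatform Ψ) (hm : Matches Γ Ψ Δ)
    {x : ℕ} {w : Tm} (h : Ψ.lookup x = some w) : cv w = ∅ := by
  obtain ⟨v, hv, ρ, rfl⟩ := Store.exists_of_lookup h
  rw [cv_ren, show cv v = ∅ from ?_]
  · rfl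
  · refine Finset.eq_empty_of_forall_notMem fun c hc => ?_
    cases c with
    | star => exact hm.star_notMem_cv v hv hc
    | var i => simpa [(hΨ v hv).2] using mem_fv_of_mem_cv hc

/-- A box always has its content as a free variable, so no closed value is a box. -/
theorem IsPlatform.lookup_ne_box {Ψ : Store} (hΨ : IsPlatform Ψ) {x y : ℕ} :
    Ψ.lookup x ≠ some (.box y) := by
  intro h
  obtain ⟨v, hv, ρ, hw⟩ := Store.exists_of_lookup h
  have hfv := (hΨ v hv).2
  cases v <;> simp [Tm.ren, Tm.fv] at hw hfv

/-- The captured variables of a value in the store are accounted for by its variable. -/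
theorem resolve_cv_lookup {Ψ : Store} (hΨ : ∀ x w, Ψ.lookup x = some w → cv w = ∅)
    (σ : Store) {x : ℕ} {w : Tm} (h : Store.lookup (Ψ ++ σ) x = some w) :
    resolve σ (cv w) ⊆ resolve σ {.var x} := by
  induction σ using List.reverseRecOn generalizing x w with
  | nil =>
    rw [List.append_nil] at h
    -- With no local binding left, `x` belongs to the platform, whose values capture nothing.
    simp [hΨ x w h, resolve]
  | append_singleton σ v ih =>
    rw [← List.append_assoc] at h
    rw [resolve_snoc, resolve_snoc]
    cases x with
    | zero =>
      rw [Store.lookup_snoc_zero] at h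
      cases h
      rw [cv_ren, bindCv_ren_succ, bindCv_zero]
    | succ x =>
      rw [Store.lookup_snoc_succ, Option.map_eq_some_iff] at h
      obtain ⟨u, hu, rfl⟩ := h
      rw [cv_ren, bindCv_ren_succ, bindCv_succ]
      exact ih hu

/-! ### Typed store contexts -/

/-- `Γ` extends `Δ` by bindings for the values of the store context `σ`. -/
inductive Extends (Δ : Ctx) : Store → Ctx → Prop
  | nil : Extends Δ [] Δ
  | snoc {σ : Store} {Γ : Ctx} {v : Tm} {T : Ty} :
      Extends Δ σ Γ → v.isValue = true → HasType Γ v T → Extends Δ (σ ++ [v]) (.tm T :: Γ)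

theorem Extends.of_hasType {Δ Γ : Ctx} {σ₀ σ : Store} {u : Tm} {T : Ty} (h₀ : Extends Δ σ₀ Γ)
    (hσ : σ.IsStore) (h : HasType Γ (σ.plug u) T) :
    ∃ Γ' U, Extends Δ (σ₀ ++ σ) Γ' ∧ HasType Γ' u U := by
  induction σ generalizing σ₀ Γ T with
  | nil => exact ⟨Γ, T, by simpa using h₀, h⟩
  | cons v σ ih =>
    obtain ⟨T', U', hv, hb⟩ := HasType.letin_inv h
    obtain ⟨Γ', U, h₁, h₂⟩ := ih (h₀.snoc (hσ v List.mem_cons_self) hv)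
      (fun w hw => hσ w (List.mem_cons_of_mem _ hw)) hb
    exact ⟨Γ', U, by simpa using h₁, h₂⟩

/-- Soundness of subcapturing for resolution: monotonicity and unions handle the first two rules,
and the hypothesis on bindings is exactly what the lookup rule needs. -/
theorem SubCapt.resolve_subset {Γ : Ctx} {σ : Store}
    (hσ : ∀ x C S, HasVar Γ x (.capt C S) → CVar.star ∉ C →
      resolve σ {.var x} ⊆ resolve σ C)
    {D C : CapSet} (h : SubCapt Γ D C) (hC : CVar.star ∉ C) : resolve σ D ⊆ resolve σ C := by
  induction h with
  | elem hm => exact resolve_mono σ (Finset.singleton_subset_iff.2 hm)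
  | set _ ih => exact resolve_subset_of_forall σ fun c hc => ih c hc hC
  | var hx h ih => exact (hσ _ _ _ hx fun hs => hC (h.star_mem hs)).trans (ih hC)

theorem Ty.shift_eq_capt {T : Ty} {C : CapSet} {S : Shape} (h : T.shift = .capt C S) :
    C = CapSet.ren Nat.succ T.cs ∧ S = T.shape.shift := by
  cases T with
  | capt C' S' =>
    simp only [Ty.shift, Ty.ren, Ty.capt.injEq] at h
    exact ⟨h.1.symm, h.2.symm⟩

theorem HasVar.tm_zero_inv {Γ : Ctx} {T : Ty} {C : CapSet} {S : Shape}
    (h : HasVar (.tm T :: Γ) 0 (.capt C S)) :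
    C = CapSet.ren Nat.succ T.cs ∧ S = T.shape.shift := by
  generalize hU : Ty.capt C S = U at h
  cases h
  exact Ty.shift_eq_capt hU.symm

theorem HasVar.tm_succ_inv {Γ : Ctx} {T : Ty} {x : ℕ} {C : CapSet} {S : Shape}
    (h : HasVar (.tm T :: Γ) (x + 1) (.capt C S)) :
    ∃ C' S', HasVar Γ x (.capt C' S') ∧ C = CapSet.ren Nat.succ C' ∧ S = S'.shift := by
  generalize hU : Ty.capt C S = U at h
  cases h with
  | @there_tm _ _ T' _ h =>
    cases T' with
    | capt C' S' => exact ⟨C', S', h, Ty.shift_eq_capt hU.symm⟩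

/-- A local variable resolves to `cv v`, which subcaptures its declared set; soundness in the
shorter store, given by induction, finishes. Variables of `Δ` are excluded by their `*`. -/
theorem Extends.resolve_var {Δ Γ : Ctx} {σ : Store} (h : Extends Δ σ Γ)
    (hΔ : ∀ x C S, HasVar Δ x (.capt C S) → CVar.star ∈ C) :
    ∀ x C S, HasVar Γ x (.capt C S) → CVar.star ∉ C → resolve σ {.var x} ⊆ resolve σ C := by
  induction h with
  | nil => exact fun x C S hx hC => absurd (hΔ x C S hx) hC
  | snoc _ hv ht ih =>
    intro x C S hx hC
    rw [resolve_snoc, resolve_snoc]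
    cases x with
    | zero =>
      obtain ⟨rfl, -⟩ := hx.tm_zero_inv
      rw [bindCv_zero, bindCv_ren_succ]
      exact (ht.cv_value_subCapt hv).resolve_subset ih fun hs => hC (CapSet.star_mem_ren.2 hs)
    | succ x =>
      obtain ⟨C', S', hx', rfl, -⟩ := hx.tm_succ_inv
      rw [bindCv_succ, bindCv_ren_succ]
      exact ih x C' S' hx' fun hs => hC (CapSet.star_mem_ren.2 hs)

/-- A variable that the store binds to `□ y` has a type `□ T'` (or `⊤`) whose capture set
accounts for `y`. -/
theorem Extends.resolve_box {Δ Γ : Ctx} {Ψ σ : Store} (h : Extends Δ σ Γ)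
    (hΔ : ∀ x C S, HasVar Δ x (.capt C S) → CVar.star ∈ C)
    (hΨ : ∀ x y, Ψ.lookup x ≠ some (.box y)) :
    ∀ {x y : ℕ} {C : CapSet} {S : Shape}, Store.lookup (Ψ ++ σ) x = some (.box y) →
      HasVar Γ x (.capt C S) →
      S = .top ∨ ∃ T', S = .box T' ∧
        (CVar.star ∉ T'.cs → resolve σ {.var y} ⊆ resolve σ T'.cs) := by
  induction h with
  | nil =>
    intro x y C S hl _
    rw [List.append_nil] at hl
    exact absurd hl (hΨ x y)
  | @snoc σ Γ v T hext hv ht ih =>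
    intro x y C S hl hx
    rw [← List.append_assoc] at hl
    cases x with
    | zero =>
      obtain ⟨-, rfl⟩ := hx.tm_zero_inv
      rw [Store.lookup_snoc_zero] at hl
      -- Renaming preserves the head constructor, so only a box survives.
      cases v <;> simp only [Tm.ren, Option.some.injEq, reduceCtorEq, Tm.box.injEq] at hl
      subst hl
      rcases ht.box_inv with h | ⟨T', h, hs⟩
      · exact .inl (by rw [h]; rfl)
      · obtain ⟨C', S'⟩ := T'
        refine .inr ⟨(Ty.capt C' S').shift, by rw [h]; rfl, fun hstar => ?_⟩
        rw [resolve_snoc, resolve_snoc, bindCv_succ]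
        refine (hs.resolve_subset (hext.resolve_var hΔ)
          fun h => hstar (CapSet.star_mem_ren.2 h)).trans (Eq.subset ?_)
        exact congrArg _ (bindCv_ren_succ _ _).symm
    | succ x =>
      obtain ⟨C', S', hx', -, rfl⟩ := hx.tm_succ_inv
      rw [Store.lookup_snoc_succ, Option.map_eq_some_iff] at hl
      obtain ⟨u, hu, hl⟩ := hl
      cases u <;> simp only [Tm.ren, reduceCtorEq, Tm.box.injEq] at hl
      subst hl
      rcases ih hu hx' with rfl | ⟨T', rfl, hs⟩
      · exact .inl rfl
      · obtain ⟨C₁, S₁⟩ := T'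
        refine .inr ⟨(Ty.capt C₁ S₁).shift, rfl, fun hstar => ?_⟩
        rw [resolve_snoc, resolve_snoc, bindCv_succ]
        refine (hs fun h => hstar (CapSet.star_mem_ren.2 h)).trans (Eq.subset ?_)
        exact congrArg _ (bindCv_ren_succ _ _).symm

theorem HasVar.lt_of_matches {Γ Δ : Ctx} {σ : Store} (hm : Matches Γ σ Δ) {x : ℕ} {T : Ty}
    (h : HasVar Δ x T) : x < σ.length := by
  have key : ∀ {Γ' : Ctx} {y : ℕ} {U : Ty}, HasVar Γ' y U → y < Γ'.length := by
    intro Γ' y U h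
    induction h <;> simp <;> omega
  have hlen : Δ.length = σ.length := by
    clear h
    induction hm with
    | nil => rfl
    | cons _ _ _ ih => simp [ih]
  exact hlen ▸ key h

theorem HasVar.unique {Γ : Ctx} {x : ℕ} {T U : Ty} (h : HasVar Γ x T) (h' : HasVar Γ x U) :
    T = U := by
  induction h generalizing U with
  | here => cases h'; rfl
  | there_tm _ ih => cases h' with | there_tm h' => rw [ih h']
  | there_tp _ ih => cases h' with | there_tp h' => rw [ih h']

/-! ### Evaluation contexts -/

/-- The captured variables contributed by an evaluation context. -/
def ECtx.cvs (e : ECtx) : CapSet := e.foldr (fun t A => A ∪ (cv t).unbind) ∅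

theorem ECtx.isValue_plug (e : ECtx) {u : Tm} (hu : u.isValue = false) :
    (e.plug u).isValue = false := by
  cases e with
  | nil => exact hu
  | cons b e => rfl

/-- Only an inclusion: if `u` is a value, the enclosing `let` may drop its captured variables. -/
theorem ECtx.cv_plug_subset (e : ECtx) (u : Tm) : cv (e.plug u) ⊆ cv u ∪ e.cvs := by
  induction e with
  | nil => exact Finset.subset_union_left
  | cons b e ih =>
    refine (cv_letin_subset _ _).trans ?_
    rw [ECtx.cvs, List.foldr_cons, ← Finset.union_assoc]
    exact Finset.union_subset_union_left ih

theorem ECtx.cv_plug (e : ECtx) {u : Tm} (hu : u.isValue = false) :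
    cv (e.plug u) = cv u ∪ e.cvs := by
  induction e with
  | nil => exact (Finset.union_empty _).symm
  | cons b e ih =>
    rw [ECtx.plug, cv_letin_of_not_isValue (ECtx.isValue_plug e hu), ih, Finset.union_assoc]
    rfl

theorem ECtx.cvs_shift (e : ECtx) : (ECtx.shift e).cvs = CapSet.ren Nat.succ e.cvs := by
  induction e with
  | nil => rfl
  | cons b e ih =>
    have h : (ECtx.shift e).cvs ∪ (cv (b.ren (up Nat.succ) id)).unbind =
        CapSet.ren Nat.succ (ECtx.cvs e ∪ (cv b).unbind) := by
      rw [ih, cv_ren, CapSet.unbind_ren_up]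
      exact (Finset.image_union _ _).symm
    exact h

/-- A let-bound value can only be at the root of `e[u]` if it is at the root of `u`. -/
theorem ECtx.plug_ne_letin_value {e : ECtx} {u : Tm} (hu : u.isValue = false)
    (hl : e = [] → ∀ v b, v.isValue = true → u ≠ .letin v b) (v b : Tm)
    (hv : v.isValue = true) : e.plug u ≠ .letin v b := by
  cases e with
  | nil => exact hl rfl v b hv
  | cons c e =>
    intro h
    cases h
    rw [ECtx.isValue_plug e hu] at hv
    cases hv

-- Splitting the store of a step at the platform

theorem Store.plug_append (σ τ : Store) (u : Tm) :
    Store.plug (σ ++ τ) u = σ.plug (τ.plug u) := by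
  induction σ with
  | nil => rfl
  | cons v σ ih => simp [Store.plug, ih]

theorem Store.plug_injective (σ : Store) : Function.Injective σ.plug := by
  intro u w h
  induction σ with
  | nil => exact h
  | cons v σ ih =>
    simp only [Store.plug, Tm.letin.injEq, true_and] at h
    exact ih h

theorem Store.prefix_of_plug_eq {Ψ σ : Store} {t r : Tm} (hΨ : Ψ.IsStore)
    (hr : ∀ v b, v.isValue = true → r ≠ .letin v b) (h : σ.plug r = Ψ.plug t) :
    ∃ τ, σ = Ψ ++ τ ∧ t = τ.plug r := by
  induction Ψ generalizing σ with
  | nil => exact ⟨σ, rfl, h.symm⟩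
  | cons v Ψ ih =>
    cases σ with
    -- A store shorter than `Ψ` would leave a platform binding at the root of `r`.
    | nil => exact absurd h (hr v _ (hΨ v List.mem_cons_self))
    | cons w σ =>
      simp only [Store.plug, Tm.letin.injEq] at h
      obtain ⟨rfl, h⟩ := h
      obtain ⟨τ, rfl, ht⟩ := ih (fun w hw => hΨ w (List.mem_cons_of_mem _ hw)) h
      exact ⟨τ, rfl, ht⟩

/-- Reduction of a redex `r` to `r'` under a store and an evaluation context does not enlarge the
captured variables, provided `r'` captures no more than `r` relative to the local store. -/
theorem cv_subset_of_plug {Ψ σ : Store} {e : ECtx} {t t' r r' : Tm} (hΨ : Ψ.IsStore)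
    (hσ : σ.IsStore) (hr : r.isValue = false)
    (hl : ∀ v b, v.isValue = true → r ≠ .letin v b)
    (ht : σ.plug (e.plug r) = Ψ.plug t) (ht' : σ.plug (e.plug r') = Ψ.plug t')
    (h : ∀ τ, σ = Ψ ++ τ → t = τ.plug (e.plug r) → τ.IsStore →
      resolve τ (cv r') ⊆ resolve τ (cv r)) :
    cv t' ⊆ cv t := by
  obtain ⟨τ, rfl, rfl⟩ := Store.prefix_of_plug_eq hΨ
    (ECtx.plug_ne_letin_value hr fun _ => hl) ht
  have hτ : τ.IsStore := fun v hv => hσ v (List.mem_append_right _ hv)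
  rw [Store.plug_append] at ht'
  rw [← Store.plug_injective Ψ ht', cv_plug hτ, cv_plug hτ, e.cv_plug hr]
  refine (resolve_mono τ (e.cv_plug_subset r')).trans ?_
  rw [resolve_union, resolve_union]
  exact Finset.union_subset_union_left (h τ rfl rfl hτ)

/-- The lifted context is weakened past `v`, so its contribution neither triggers the capture of `v`
nor changes. -/
theorem cv_lift_subset (e : ECtx) {v t : Tm} (hv : v.isValue = true) :
    cv (.letin v (e.shift.plug t)) ⊆ cv (e.plug (.letin v t)) := by
  have hlet : ∀ u, cv (.letin v u) = bindCv v (cv u) := fun u =>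
    cv_plug (σ := [v]) (by simpa [Store.IsStore] using hv) u
  have hmono : bindCv v (cv (e.shift.plug t)) ⊆ bindCv v (cv t ∪ (ECtx.shift e).cvs) :=
    resolve_mono [v] (ECtx.cv_plug_subset e.shift t)
  rw [e.cv_plug rfl, hlet, hlet]
  rwa [bindCv_union, ECtx.cvs_shift, bindCv_ren_succ] at hmono

end CC

-- Case analysis on the reduction rules

theorem mainTheorem6 (Ψ : CC.Store) (t t' : CC.Tm)
    (hprog : CC.WellTypedProgram Ψ t)
    (hstep : CC.Step (Ψ.plug t) (Ψ.plug t')) :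
    CC.cv t' ⊆ CC.cv t := by
  open CC in
  obtain ⟨hplat, Δ, hm, ⟨T, htT⟩, hdom⟩ := hprog
  have hΨ : Ψ.IsStore := fun v hv => (hplat v hv).1
  have hcv : ∀ x w, Ψ.lookup x = some w → cv w = ∅ := fun x w =>
    cv_eq_empty_of_lookup hplat hm
  -- All variables of `Δ` are platform variables, hence declared with `{*}`.
  have hΔ : ∀ x C S, HasVar Δ x (.capt C S) → CVar.star ∈ C := by
    intro x C S hx
    obtain ⟨S', hx'⟩ := hdom x (hx.lt_of_matches hm)
    cases hx.unique hx'
    exact Finset.mem_singleton_self _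
  generalize hs : Ψ.plug t = s at hstep
  generalize hs' : Ψ.plug t' = s' at hstep
  cases hstep with
  | @apply σ e x y U b hσ hl =>
    refine cv_subset_of_plug hΨ hσ rfl (fun _ _ _ => Tm.noConfusion) hs.symm hs'.symm ?_
    rintro τ rfl - -
    refine (resolve_mono τ (cv_inst_subset y b)).trans ?_
    have h := resolve_cv_lookup hcv τ hl
    rw [cv, Finset.insert_eq, resolve_union, resolve_union, Finset.union_comm]
    exact Finset.union_subset_union_left h
  | @tapply σ e x S S' b hσ hl =>
    refine cv_subset_of_plug hΨ hσ rfl (fun _ _ _ => Tm.noConfusion) hs.symm hs'.symm ?_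
    rintro τ rfl - -
    rw [Tm.tinst, cv_subst]
    exact resolve_cv_lookup hcv τ (w := .tlam S' b) hl
  | @rename σ e y b hσ =>
    refine cv_subset_of_plug hΨ hσ rfl ?_ hs.symm hs'.symm ?_
    · rintro v b hv h
      cases h
      cases hv
    · rintro τ - - -
      rw [cv_letin_of_not_isValue rfl]
      exact resolve_mono τ (cv_inst_subset y b)
  | @lift σ e v b hσ hv he =>
    obtain ⟨τ, rfl, rfl⟩ := Store.prefix_of_plug_eq hΨ
      -- Here the redex is itself a `let` of a value; `e ≠ []` keeps it away from the root.
      (ECtx.plug_ne_letin_value rfl fun h => absurd h he) hs.symm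
    have hτ : τ.IsStore := fun v hv => hσ v (List.mem_append_right _ hv)
    rw [Store.plug_append] at hs'
    rw [Store.plug_injective Ψ hs', cv_plug hτ, cv_plug hτ]
    exact resolve_mono τ (cv_lift_subset e hv)
  -- The remaining rule is unboxing.
  | _ =>
    rename_i σ e C x y hσ hl
    refine cv_subset_of_plug hΨ hσ rfl (fun _ _ _ => Tm.noConfusion) hs.symm hs'.symm ?_
    rintro τ rfl rfl hτ
    obtain ⟨Γ, U, hext, hU⟩ := (Extends.nil (Δ := Δ)).of_hasType hτ htT
    rw [List.nil_append] at hext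
    obtain ⟨_, hub⟩ := hU.of_plug
    obtain ⟨S, hx, hC⟩ := hub.unbox_inv
    have hstar : CVar.star ∉ C := fun h => star_notMem_dom Γ (hC h)
    obtain ⟨C₀, S₀, hxv, hsub⟩ := hx.var_inv
    -- The part `C` of `cv (C ⊸ x) = C ∪ {x}` already suffices.
    refine LE.le.trans ?_ (resolve_mono τ Finset.subset_union_left)
    rcases hext.resolve_box hΔ (fun _ _ => hplat.lookup_ne_box) hl hxv with rfl | ⟨T', rfl, hy⟩
    -- If `x` were declared with shape `⊤`, it could not be used at a box type.
    · cases hsub.shape_top rfl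
    · rcases hsub.shape_box rfl with h | ⟨U', h, hc⟩
      · cases h
      · cases h
        exact (hy fun h => hstar (hc.star_mem h)).trans
          (hc.resolve_subset (hext.resolve_var hΔ) hstar)
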